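/- Let $E(u)=(1-u)e^{u}$. A canonical product of genus one is an entire function of the form $\Pi(z)=\prod_k E(z w_k)$ with $w_k\in\mathbb C$, $\sum_k|w_k|^2<\infty$; its zeros, counted with multiplicity, are the points $z_k=1/w_k$ with $w_k\neq 0$ (finite products are allowed). Put $M(r,\Pi)=\max_{|z|=r}|\Pi(z)|$, $$\gamma_p(\Pi)=\sum_k\left|\operatorname{Im}\frac1{z_k}\right|^p,\qquad \alpha_p(\Pi^{-1})=\frac1\pi\int_{-\infty}^{\infty}\frac{\log^-|\Pi(t)|}{|t|^{p+1}}\,dt,$$ where the sum is over the zeros of $\Pi$ counted with multiplicity, $\log^- x=\max(-\log x,0)$, and both quantities may equal $+\infty$. Theorem. For every $p$ with $1<p<2$ there is a constant $K_p$, $0<K_p<\infty$, depending only on $p$, such that for every canonical product $\Pi$ of genus one $$\int_0^\infty\frac{\log M(r,\Pi)}{r^{p+1}}\,dr\le K_p\bigl(\gamma_p(\Pi)+\alpha_p(\Pi^{-1})\bigr)$$ and $$\sum_k\frac1{|z_k|^p}\le K_p\bigl(\gamma_p(\Pi)+\alpha_p(\Pi^{-1})\bigr).$$ -/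

import Mathlib

open scoped ENNReal NNReal

noncomputable section

namespace EntireFn

/-- The Weierstrass primary factor of genus one, `E(u) = (1 - u) e^u`. -/
def primaryFactor (u : ℂ) : ℂ := (1 - u) * Complex.exp u

/-- `f` is a canonical product of genus one: `f(z) = ∏ₖ E(z wₖ)` with `∑ₖ |wₖ|² < ∞`.
The zeros of `f` are the points `zₖ = 1 / wₖ` for the indices with `wₖ ≠ 0`; since an index with
`wₖ = 0` contributes the factor `E(0) = 1`, finite products (and the empty one) are included. -/
def IsCanonicalProductGenusOne (f : ℂ → ℂ) : Prop :=
  ∃ w : ℕ → ℂ, Summable (fun k => ‖w k‖ ^ 2) ∧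
    ∀ z : ℂ, HasProd (fun k => primaryFactor (z * w k)) (f z)

/-- The maximum modulus `M(r, f) = max_{|z| = r} |f(z)|`. -/
def maxModulus (f : ℂ → ℂ) (r : ℝ) : ℝ :=
  sSup ((fun z : ℂ => ‖f z‖) '' Metric.sphere (0 : ℂ) r)

/-- The sum of `g` over the zeros of `f`, each zero counted with its multiplicity. -/
def zeroSum (f : ℂ → ℂ) (g : ℂ → ℝ≥0∞) : ℝ≥0∞ :=
  ∑' z : {z : ℂ // f z = 0}, (analyticOrderAt f (z : ℂ) : ℝ≥0∞) * g (z : ℂ)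

/-- `γ_p(f) = ∑ₖ |Im (1 / zₖ)|^p` over the zeros of `f` with multiplicity, possibly `+∞`. -/
def gammaP (p : ℝ) (f : ℂ → ℂ) : ℝ≥0∞ :=
  zeroSum f fun z => ENNReal.ofReal (|(z⁻¹).im| ^ p)

/-- `α_p(f) = (1 / π) ∫_ℝ log⁺|f(t)| / |t|^(p+1) dt`, possibly `+∞`. Applied to the pointwise
inverse `f⁻¹` this is the same integral with `log⁻|f|` in place of `log⁺|f|`, because
`log⁺(1 / |f|) = log⁻|f|` off the zeros of `f`. -/
def alphaP (p : ℝ) (f : ℂ → ℂ) : ℝ≥0∞ :=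
  ENNReal.ofReal (1 / Real.pi) *
    ∫⁻ t : ℝ, ENNReal.ofReal (Real.posLog ‖f (t : ℂ)‖ / |t| ^ (p + 1))

end EntireFn

end

noncomputable section

namespace EntireFn

open Filter Topology MeasureTheory Set

/-! Multiplying the values at `t` and `-t` cancels the exponential factors: `|f(t) f(-t)| = ∏ |1 -
(t wₖ)²|`. Hence, after division by `t ^ (p + 1)` and integration over `(0, ∞)`, `∑ₖ ∫ log |1 - (t
wₖ)²| / t ^ (p + 1)` is bounded below by `-π α_p`. The proof bounds each summand above by `-c |w| ^
p + C |Im w| ^ p`, so that `c ∑ |wₖ| ^ p ≤ π α_p + C γ_p`. The growth estimate follows from `log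
|E(u)| ≤ min (|u|²) (2 |u|)`, integrated against `r ^ (-p - 1)`.

The kernel estimate (`exists_ofReal_add_posInt_le`) is delicate only for `w` near the real axis;
elsewhere `|w|` is comparable to `|Im w|`. With weight `t ^ (-2)` there is an explicit primitive,
and the integral is at most `2 π |Im w|` (`integral_log_div_sq_le`). The logarithm is negative
before a single sign change and positive after it, so passing to the steeper weight `t ^ (-p - 1)`
favours the negative part and gains a multiple of `|w| ^ p` (`log_div_rpow_le`).

Since `∑ |wₖ| ^ p` is not known in advance to be finite, everything is done on `(0, R)`, where `∑
|wₖ|² < ∞` makes the positive parts summable. They are cancelled there, and only then is `R` made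
large. -/

/-! ### Genus-one products: convergence, zeros and multiplicities. -/

lemma primaryFactor_eq_zero_iff {u : ℂ} : primaryFactor u = 0 ↔ u = 1 := by
  simp only [primaryFactor, mul_eq_zero, Complex.exp_ne_zero, or_false, sub_eq_zero]
  exact eq_comm

lemma differentiable_primaryFactor : Differentiable ℂ primaryFactor := by
  unfold primaryFactor; fun_prop

lemma norm_primaryFactor_sub_one_le {u : ℂ} (hu : ‖u‖ ≤ 1) :
    ‖primaryFactor u - 1‖ ≤ 3 * ‖u‖ ^ 2 := by
  have h : primaryFactor u - 1 = (Complex.exp u - 1 - u) - u * (Complex.exp u - 1) := by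
    unfold primaryFactor; ring
  have h1 := Complex.norm_exp_sub_one_sub_id_le hu
  have h2 := Complex.norm_exp_sub_one_le hu
  calc ‖primaryFactor u - 1‖ ≤ ‖Complex.exp u - 1 - u‖ + ‖u‖ * ‖Complex.exp u - 1‖ := by
        rw [h, ← norm_mul]; exact norm_sub_le _ _
    _ ≤ ‖u‖ ^ 2 + ‖u‖ * (2 * ‖u‖) := by gcongr
    _ = 3 * ‖u‖ ^ 2 := by ring

lemma eventually_norm_primaryFactor_sub_one_le {w : ℕ → ℂ} (hw : Summable fun k => ‖w k‖ ^ 2)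
    (r : ℝ) :
    ∀ᶠ k in cofinite, ∀ z ∈ Metric.ball (0 : ℂ) r,
      ‖primaryFactor (z * w k) - 1‖ ≤ 3 * r ^ 2 * ‖w k‖ ^ 2 := by
  have h1 : ∀ᶠ k in cofinite, r ^ 2 * ‖w k‖ ^ 2 < 1 := by
    have := (hw.mul_left (r ^ 2)).tendsto_cofinite_zero
    exact this.eventually_lt_const one_pos
  filter_upwards [h1] with k hk z hz
  have hz' : ‖z‖ < r := by simpa using hz
  have h2 : ‖z * w k‖ ^ 2 ≤ r ^ 2 * ‖w k‖ ^ 2 := by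
    rw [norm_mul, mul_pow]; gcongr
  have h3 : ‖z * w k‖ ≤ 1 := by
    have : ‖z * w k‖ ^ 2 ≤ 1 ^ 2 := by linarith
    exact le_of_sq_le_sq this one_pos.le
  calc _ ≤ 3 * ‖z * w k‖ ^ 2 := norm_primaryFactor_sub_one_le h3
    _ ≤ _ := by linarith

lemma summable_norm_primaryFactor_sub_one {w : ℕ → ℂ} (hw : Summable fun k => ‖w k‖ ^ 2)
    (z : ℂ) :
    Summable fun k => ‖primaryFactor (z * w k) - 1‖ := by
  refine Summable.of_norm_bounded_eventually (hw.mul_left (3 * (‖z‖ + 1) ^ 2)) ?_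
  filter_upwards [eventually_norm_primaryFactor_sub_one_le hw (‖z‖ + 1)] with k hk
  rw [norm_norm]
  exact hk z (by simp)

lemma hasProd_primaryFactor {w : ℕ → ℂ} (hw : Summable fun k => ‖w k‖ ^ 2)
    (z : ℂ) :
    HasProd (fun k => primaryFactor (z * w k)) (∏' k, primaryFactor (z * w k)) := by
  have := multipliable_one_add_of_summable (summable_norm_primaryFactor_sub_one hw z)
  simpa using this.hasProd

lemma product_ne_zero {w : ℕ → ℂ} (hw : Summable fun k => ‖w k‖ ^ 2) {f : ℂ → ℂ}
    (hf : ∀ z, HasProd (fun k => primaryFactor (z * w k)) (f z))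
    {z : ℂ} (hz : ∀ k, z * w k ≠ 1) : f z ≠ 0 := by
  rw [← (hf z).tprod_eq]
  have := tprod_one_add_ne_zero_of_summable (f := fun k => primaryFactor (z * w k) - 1)
    (fun k => by simpa [primaryFactor_eq_zero_iff] using hz k)
    (summable_norm_primaryFactor_sub_one hw z)
  simpa using this

lemma differentiable_product {w : ℕ → ℂ} (hw : Summable fun k => ‖w k‖ ^ 2) {f : ℂ → ℂ}
    (hf : ∀ z, HasProd (fun k => primaryFactor (z * w k)) (f z))
    : Differentiable ℂ f := by
  intro z
  have hopen : IsOpen (Metric.ball (0 : ℂ) (‖z‖ + 1)) := Metric.isOpen_ball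
  have h := Summable.hasProdLocallyUniformlyOn_one_add hopen
    (hw.mul_left (3 * (‖z‖ + 1) ^ 2)) (eventually_norm_primaryFactor_sub_one_le hw (‖z‖ + 1))
    (fun k => by
      have := differentiable_primaryFactor.continuous
      fun_prop)
  have h2 := hasProdLocallyUniformlyOn_iff_tendstoLocallyUniformlyOn.mp h
  have h3 := h2.differentiableOn (.of_forall fun s => by
      have := differentiable_primaryFactor
      fun_prop) hopen
  have h4 := h3.differentiableAt (hopen.mem_nhds (x := z) (by simp))
  refine h4.congr_of_eventuallyEq (.of_forall fun y => ?_)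
  simp [(hf y).tprod_eq]

lemma finite_setOf_mul_eq_one {w : ℕ → ℂ} (hw : Summable fun k => ‖w k‖ ^ 2)
    (z : ℂ) : {k | z * w k = 1}.Finite := by
  have h := (summable_norm_primaryFactor_sub_one hw z).tendsto_cofinite_zero.eventually_lt_const
    one_pos
  refine (Filter.eventually_cofinite.mp h).subset fun k hk => ?_
  have : z * w k = 1 := hk
  simp [this, primaryFactor]

lemma analyticOrderAt_product {w : ℕ → ℂ} (hw : Summable fun k => ‖w k‖ ^ 2) {f : ℂ → ℂ}
    (hf : ∀ z, HasProd (fun k => primaryFactor (z * w k)) (f z))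
    (z : ℂ) :
    (analyticOrderAt f z : ℝ≥0∞) = ∑' k, if z * w k = 1 then 1 else 0 := by
  classical
  set S := (finite_setOf_mul_eq_one hw z).toFinset with hS
  have hmem : ∀ k, k ∈ S ↔ z * w k = 1 := by simp [hS]
  have hsum : (∑' k, if z * w k = 1 then 1 else 0 : ℝ≥0∞) = S.card := by
    rw [tsum_eq_sum (s := S)]
    · rw [Finset.sum_congr rfl fun k hk => if_pos ((hmem k).1 hk)]; simp
    · intro k hk; exact if_neg (by rwa [← hmem])
  -- Setting `w k` to `0` on `S` deletes exactly the factors vanishing at `z`, because `E(0) = 1`;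
  -- what remains is again a genus-one product, nonzero at `z`.
  have hw' : Summable fun k => ‖if k ∈ S then 0 else w k‖ ^ 2 := by
    refine hw.of_nonneg_of_le (fun k => by positivity) fun k => ?_
    split_ifs <;> simp
  set g : ℂ → ℂ := fun x => ∏' k, primaryFactor (x * if k ∈ S then 0 else w k)
  have hg := fun x => hasProd_primaryFactor hw' x
  have hfg : ∀ x, f x = (∏ k ∈ S, primaryFactor (x * w k)) * g x := by
    intro x
    have h1 : HasProd (fun k => if k ∈ S then primaryFactor (x * w k) else 1)
        (∏ k ∈ S, primaryFactor (x * w k)) := by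
      have := hasProd_prod_of_ne_finset_one (s := S)
        (f := fun k => if k ∈ S then primaryFactor (x * w k) else 1) (L := .unconditional ℕ)
        (fun k hk => if_neg hk)
      rwa [Finset.prod_congr rfl fun k hk => if_pos hk] at this
    refine (hf x).unique ((h1.mul (hg x)).congr_fun ?_)
    intro k
    split_ifs <;> simp [primaryFactor]
  have hgd : Differentiable ℂ g := differentiable_product hw' hg
  have hg0 : g z ≠ 0 := product_ne_zero hw' hg fun k => by
    split_ifs with h
    · simp
    · rwa [ne_eq, ← hmem]
  have hord : analyticOrderAt f z = (S.card : ℕ) := by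
    rw [((differentiable_product hw hf).analyticAt z).analyticOrderAt_eq_natCast]
    refine ⟨fun x => (∏ k ∈ S, (-w k * Complex.exp (x * w k))) * g x, ?_, ?_, ?_⟩
    · exact Differentiable.analyticAt (by fun_prop) z
    · refine mul_ne_zero (Finset.prod_ne_zero_iff.2 fun k hk => ?_) hg0
      have := (hmem k).1 hk
      refine mul_ne_zero (neg_ne_zero.2 fun h => ?_) (Complex.exp_ne_zero _)
      simp [h] at this
    · refine .of_forall fun x => ?_
      rw [hfg, smul_eq_mul, ← mul_assoc, ← Finset.prod_const, ← Finset.prod_mul_distrib]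
      congr 1
      refine Finset.prod_congr rfl fun k hk => ?_
      have := (hmem k).1 hk
      unfold primaryFactor
      linear_combination (-Complex.exp (x * w k)) * this
  rw [hsum, hord]; simp

/-- The order at `z` counts the indices with `z * w k = 1`, so exchanging the two sums leaves one
zero for each nonzero `w k`. -/
lemma zeroSum_product {w : ℕ → ℂ} (hw : Summable fun k => ‖w k‖ ^ 2) {f : ℂ → ℂ}
    (hf : ∀ z, HasProd (fun k => primaryFactor (z * w k)) (f z))
    (g : ℂ → ℝ≥0∞) :
    zeroSum f g = ∑' k, if w k = 0 then 0 else g (w k)⁻¹ := by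
  unfold zeroSum
  simp_rw [analyticOrderAt_product hw hf, ← ENNReal.tsum_mul_right]
  rw [ENNReal.tsum_comm]
  congr 1 with k
  have hz : ∀ z, z * w k = 1 ↔ w k ≠ 0 ∧ z = (w k)⁻¹ := by
    intro z
    by_cases h : w k = 0
    · simp [h]
    · simp only [ne_eq, h, not_false_eq_true, true_and]
      rw [← one_mul (w k)⁻¹]; exact (eq_mul_inv_iff_mul_eq₀ h).symm
  split_ifs with h
  · simp [h]
  · have h0 : f (w k)⁻¹ = 0 := by
      rw [← (hf _).tprod_eq]
      exact tprod_of_exists_eq_zero ⟨k, by simp [h, primaryFactor]⟩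
    rw [tsum_eq_single ⟨(w k)⁻¹, h0⟩]
    · simp [h]
    · intro b hb
      have : ¬ (b : ℂ) * w k = 1 := by
        rw [hz]; rintro ⟨-, h1⟩; exact hb (Subtype.ext h1)
      simp [this]

/-! ### Pointwise bounds for `log |1 - (t w)²|`. -/

lemma norm_one_sub_sq_sq (t : ℝ) (w : ℂ) : ‖1 - ((t : ℂ) * w) ^ 2‖ ^ 2 =
    1 - 2 * (t ^ 2 * (w.re ^ 2 - w.im ^ 2)) + t ^ 4 * (‖w‖ ^ 2) ^ 2 := by
  rw [Complex.sq_norm, Complex.sq_norm, Complex.normSq_apply, Complex.normSq_apply]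
  simp [pow_two]
  ring

lemma log_norm_one_sub_sq_le {t : ℝ} {w : ℂ} (h : 1 - ((t : ℂ) * w) ^ 2 ≠ 0) :
    Real.log ‖1 - ((t : ℂ) * w) ^ 2‖ ≤
      t ^ 2 * (t ^ 2 * (‖w‖ ^ 2) ^ 2 - 2 * (w.re ^ 2 - w.im ^ 2)) / 2 := by
  have h1 : 0 < ‖1 - ((t : ℂ) * w) ^ 2‖ ^ 2 := by positivity
  have h2 := Real.log_le_sub_one_of_pos h1
  rw [Real.log_pow, norm_one_sub_sq_sq] at h2
  push_cast at h2
  linarith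

lemma log_norm_one_sub_sq_le_min {t : ℝ} (ht : 0 ≤ t) (w : ℂ) :
    Real.log ‖1 - ((t : ℂ) * w) ^ 2‖ ≤ min ((t * ‖w‖) ^ 2) (2 * (t * ‖w‖)) := by
  set s := t * ‖w‖
  have hs : 0 ≤ s := by positivity
  have h1 : ‖1 - ((t : ℂ) * w) ^ 2‖ ≤ 1 + s ^ 2 := by
    calc _ ≤ ‖(1 : ℂ)‖ + ‖((t : ℂ) * w) ^ 2‖ := norm_sub_le _ _
      _ = _ := by simp [s, abs_of_nonneg ht]
  have hmin : 0 ≤ min (s ^ 2) (2 * s) := by positivity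
  rcases (norm_nonneg (1 - ((t : ℂ) * w) ^ 2)).eq_or_lt with h0 | h0
  · rw [← h0]; simpa using hmin
  · have h2 := Real.log_le_log h0 h1
    refine h2.trans (le_min ?_ ?_)
    · have := Real.log_le_sub_one_of_pos (show 0 < 1 + s ^ 2 by positivity); linarith
    · have h3 : Real.log (1 + s ^ 2) ≤ Real.log ((1 + s) ^ 2) :=
        Real.log_le_log (by positivity) (by nlinarith)
      rw [Real.log_pow] at h3
      have := Real.log_le_sub_one_of_pos (show 0 < 1 + s by positivity)
      push_cast at h3
      linarith

/-- Each factor of `(1 - t w)(1 + t w)` is `|w|` times the distance from `1 / w` to a real point,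
hence at least `|Im w| / |w|`. -/
lemma norm_one_sub_sq_lower (t : ℝ) {w : ℂ} (hw : w.im ≠ 0) :
    (w.im ^ 2 / ‖w‖ ^ 2) ^ 2 ≤ ‖1 - ((t : ℂ) * w) ^ 2‖ ^ 2 := by
  have hb : 0 < ‖w‖ ^ 2 := by
    have : w ≠ 0 := by rintro rfl; simp at hw
    positivity
  have key : ∀ s : ℝ, w.im ^ 2 / ‖w‖ ^ 2 ≤ ‖1 - (s : ℂ) * w‖ ^ 2 := by
    intro s
    rw [div_le_iff₀ hb, Complex.sq_norm, Complex.sq_norm, Complex.normSq_apply,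
      Complex.normSq_apply]
    simp
    nlinarith [sq_nonneg (s * (w.re ^ 2 + w.im ^ 2) - w.re)]
  have h1 := key t
  have h2 := key (-t)
  have e : (1 - ((t : ℂ) * w) ^ 2) = (1 - (t : ℂ) * w) * (1 - ((-t : ℝ) : ℂ) * w) := by
    push_cast; ring
  rw [e, norm_mul, mul_pow, pow_two (w.im ^ 2 / ‖w‖ ^ 2)]
  gcongr

lemma one_sub_sq_ne_zero (t : ℝ) {w : ℂ} (hw : w.im ≠ 0) : 1 - ((t : ℂ) * w) ^ 2 ≠ 0 := by
  intro h
  have := norm_one_sub_sq_lower t hw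
  have h0 : w ≠ 0 := by rintro rfl; simp at hw
  rw [h, norm_zero, zero_pow two_ne_zero] at this
  exact absurd this (not_le.2 (by positivity))

lemma abs_log_norm_one_sub_sq_le {w : ℂ} (hw : w.im ≠ 0) :
    ∃ M : ℝ, 0 ≤ M ∧ ∀ t : ℝ, 0 ≤ t → |Real.log ‖1 - ((t : ℂ) * w) ^ 2‖| ≤ M * t ^ 2 := by
  have h0 : w ≠ 0 := by rintro rfl; simp at hw
  set c := (w.im ^ 2 / ‖w‖ ^ 2) ^ 2 with hc
  have hcpos : 0 < c := by positivity
  refine ⟨‖w‖ ^ 2 * (1 + 1 / c), by positivity, fun t ht => ?_⟩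
  rw [abs_le]
  constructor
  · have hX := norm_one_sub_sq_lower t hw
    set X := ‖1 - ((t : ℂ) * w) ^ 2‖ ^ 2 with hXdef
    have hXpos : 0 < X := hcpos.trans_le hX
    have h1 := Real.one_sub_inv_le_log_of_pos hXpos
    rw [hXdef, Real.log_pow, ← hXdef] at h1
    push_cast at h1
    have hre : w.re ^ 2 - w.im ^ 2 ≤ ‖w‖ ^ 2 := by
      rw [Complex.sq_norm, Complex.normSq_apply]; nlinarith [sq_nonneg w.im]
    have h2 : 1 - X ≤ 2 * (t ^ 2 * ‖w‖ ^ 2) := by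
      rw [hXdef, norm_one_sub_sq_sq]
      have : t ^ 2 * (w.re ^ 2 - w.im ^ 2) ≤ t ^ 2 * ‖w‖ ^ 2 := by gcongr
      have : 0 ≤ t ^ 4 * (‖w‖ ^ 2) ^ 2 := by positivity
      linarith
    have h3 : X⁻¹ - 1 ≤ 2 * (t ^ 2 * ‖w‖ ^ 2) * (1 / c) := by
      have : X⁻¹ - 1 = (1 - X) * (1 / X) := by field_simp
      rw [this]
      calc (1 - X) * (1 / X) ≤ (2 * (t ^ 2 * ‖w‖ ^ 2)) * (1 / X) := by gcongr
        _ ≤ _ := by gcongr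
    have : 0 ≤ t ^ 2 * ‖w‖ ^ 2 := by positivity
    nlinarith
  · have h1 := (log_norm_one_sub_sq_le_min ht w).trans (min_le_left _ _)
    have : 0 ≤ ‖w‖ ^ 2 * (1 / c) * t ^ 2 := by positivity
    nlinarith

/-! ### The integral with weight `t ^ (-2)`. -/

lemma measurable_log_norm_one_sub_sq (w : ℂ) :
    Measurable fun t : ℝ => Real.log ‖1 - ((t : ℂ) * w) ^ 2‖ := by
  fun_prop

lemma integrableOn_log_div_sq {w : ℂ} (hw : w.im ≠ 0) (R : ℝ) :
    IntegrableOn (fun t : ℝ => Real.log ‖1 - ((t : ℂ) * w) ^ 2‖ / t ^ 2) (Ioo 0 R) := by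
  obtain ⟨M, hM, h⟩ := abs_log_norm_one_sub_sq_le hw
  refine Measure.integrableOn_of_bounded (M := M) (by simp)
    (((measurable_log_norm_one_sub_sq w).div (by fun_prop)).aestronglyMeasurable) ?_
  filter_upwards [ae_restrict_mem measurableSet_Ioo] with t ht
  have ht0 : 0 < t := ht.1
  rw [Real.norm_eq_abs, abs_div, abs_of_pos (pow_pos ht0 2), div_le_iff₀ (by positivity)]
  exact h t ht0.le

lemma one_add_mul_mem_slitPlane (t : ℝ) {w : ℂ} (hw : w.im ≠ 0) :
    1 + (t : ℂ) * w ∈ Complex.slitPlane := by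
  rw [Complex.mem_slitPlane_iff]
  by_cases h : t = 0
  · left; simp [h]
  · right; simp [h, hw]

lemma log_norm_one_sub_sq_eq (t : ℝ) {w : ℂ} (hw : w.im ≠ 0) :
    Real.log ‖1 - ((t : ℂ) * w) ^ 2‖ =
      (Complex.log (1 + t * (-w)) + Complex.log (1 + t * w)).re := by
  have h1 := Complex.slitPlane_ne_zero (one_add_mul_mem_slitPlane t hw)
  have h2 := Complex.slitPlane_ne_zero (one_add_mul_mem_slitPlane t (w := -w) (by simpa using hw))
  rw [Complex.add_re, Complex.log_re, Complex.log_re, ← Real.log_mul (by simpa using h2)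
    (by simpa using h1), ← norm_mul]
  congr 2
  ring

lemma hasDerivAt_log_one_add_mul (t : ℝ) {w : ℂ} (hw : w.im ≠ 0) :
    HasDerivAt (fun t : ℝ => Complex.log (1 + t * w)) (w / (1 + t * w)) t := by
  have h1 : HasDerivAt (fun t : ℝ => (1 + (t : ℂ) * w)) w t := by
    simpa using (((hasDerivAt_id t).ofReal_comp).mul_const w).const_add 1
  exact h1.clog_real (one_add_mul_mem_slitPlane t hw)

/-- Integration by parts gives the primitive `F`. Since `Im w ≠ 0`, the points `1 ± t w` avoid the
branch cut, and `F` tends to `0` at `0` because the logarithm is `O(t²)`. -/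
lemma integral_log_div_sq {w : ℂ} (hw : w.im ≠ 0) {R : ℝ} (hR : 0 < R) :
    ∫ t in Ioo 0 R, Real.log ‖1 - ((t : ℂ) * w) ^ 2‖ / t ^ 2 =
      -Real.log ‖1 - ((R : ℂ) * w) ^ 2‖ / R +
        (w * (Complex.log (1 + R * (-w)) - Complex.log (1 + R * w))).re := by
  have hw' : (-w).im ≠ 0 := by simpa using hw
  set F : ℝ → ℝ := fun t => -(Complex.log (1 + t * (-w)) + Complex.log (1 + t * w)).re / t +
        (w * (Complex.log (1 + t * (-w)) - Complex.log (1 + t * w))).re with hF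
  have hder : ∀ t : ℝ, t ≠ 0 →
      HasDerivAt F (Real.log ‖1 - ((t : ℂ) * w) ^ 2‖ / t ^ 2) t := by
    intro t ht
    have hA := hasDerivAt_log_one_add_mul t hw'
    have hB := hasDerivAt_log_one_add_mul t hw
    have re : ∀ {g : ℝ → ℂ} {g' : ℂ}, HasDerivAt g g' t →
        HasDerivAt (fun t => (g t).re) g'.re t := fun h =>
      Complex.reCLM.hasFDerivAt.comp_hasDerivAt t h
    have h1 := ((re (hA.add hB)).neg.div (hasDerivAt_id t) ht).add
      (re ((hA.sub hB).const_mul w))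
    refine h1.congr_deriv ?_
    rw [log_norm_one_sub_sq_eq t hw]
    have n1 := Complex.slitPlane_ne_zero (one_add_mul_mem_slitPlane t hw)
    have n2 := Complex.slitPlane_ne_zero (one_add_mul_mem_slitPlane t hw')
    have htc : (t : ℂ) ≠ 0 := by exact_mod_cast ht
    have key : (-w / (1 + t * -w) + w / (1 + t * w)) =
        t * (w * (-w / (1 + t * -w) - w / (1 + t * w))) := by
      rw [div_add_div _ _ n2 n1, div_sub_div _ _ n2 n1, mul_div_assoc', mul_div_assoc']
      congr 1
      ring
    have key2 := congrArg Complex.re key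
    rw [Complex.re_ofReal_mul] at key2
    simp only [id, Pi.add_apply, Pi.neg_apply]
    rw [key2]
    field_simp
    ring
  have hFa : Tendsto F (𝓝[>] 0) (𝓝 0) := by
    obtain ⟨M, hM, h⟩ := abs_log_norm_one_sub_sq_le hw
    have t1 : Tendsto (fun t : ℝ => -(Complex.log (1 + t * (-w)) + Complex.log (1 + t * w)).re / t)
        (𝓝[>] 0) (𝓝 0) := by
      refine squeeze_zero_norm' (a := fun t => M * t) ?_ ?_
      · filter_upwards [self_mem_nhdsWithin] with t ht
        have ht : 0 < t := ht
        rw [← log_norm_one_sub_sq_eq t hw, Real.norm_eq_abs, abs_div, abs_neg, abs_of_pos ht,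
          div_le_iff₀ ht]
        exact (h t ht.le).trans (by nlinarith)
      · have : Tendsto (fun t : ℝ => M * t) (𝓝 0) (𝓝 (M * 0)) := by
          exact (continuous_const_mul M).tendsto 0
        rw [mul_zero] at this
        exact this.mono_left nhdsWithin_le_nhds
    have t2 : Tendsto (fun t : ℝ => (w * (Complex.log (1 + t * (-w)) -
        Complex.log (1 + t * w))).re) (𝓝[>] 0) (𝓝 0) := by
      have hc : ContinuousAt (fun t : ℝ => (w * (Complex.log (1 + t * (-w)) -
        Complex.log (1 + t * w))).re) 0 :=
        Complex.continuous_re.continuousAt.comp (continuousAt_const.mul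
          ((hasDerivAt_log_one_add_mul 0 hw').continuousAt.sub
            (hasDerivAt_log_one_add_mul 0 hw).continuousAt))
      have := hc.tendsto.mono_left (nhdsWithin_le_nhds (s := Ioi 0))
      simpa using this
    have := t1.add t2
    rwa [add_zero] at this
  have hFb : Tendsto F (𝓝[<] R) (𝓝 (F R)) :=
    (hder R hR.ne').continuousAt.tendsto.mono_left nhdsWithin_le_nhds
  have := intervalIntegral.integral_eq_sub_of_hasDerivAt_of_tendsto hR
    (fun t ht => hder t ht.1.ne')
    ((intervalIntegrable_iff_integrableOn_Ioo_of_le hR.le).2 (integrableOn_log_div_sq hw R)) hFa hFb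
  rw [intervalIntegral.integral_of_le hR.le, integral_Ioc_eq_integral_Ioo] at this
  rw [this, sub_zero, hF, log_norm_one_sub_sq_eq R hw]

/-- Once `R |w| ≥ √2` the boundary term is nonpositive, and so is the term with `Re w`, whose sign
is opposite to that of the difference of logarithms. Only `Im w` times a difference of two
arguments, each at most `π` in modulus, is left. -/
lemma integral_log_div_sq_le {w : ℂ} (hw : w.im ≠ 0) {R : ℝ} (hR : 0 < R)
    (hRw : 2 ≤ R ^ 2 * ‖w‖ ^ 2) :
    ∫ t in Ioo 0 R, Real.log ‖1 - ((t : ℂ) * w) ^ 2‖ / t ^ 2 ≤ 2 * Real.pi * |w.im| := by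
  rw [integral_log_div_sq hw hR]
  have h1 : 0 ≤ Real.log ‖1 - ((R : ℂ) * w) ^ 2‖ := by
    apply Real.log_nonneg
    have := norm_sub_norm_le (((R : ℂ) * w) ^ 2) 1
    rw [norm_sub_rev] at this
    have h2 : ‖((R : ℂ) * w) ^ 2‖ = R ^ 2 * ‖w‖ ^ 2 := by
      rw [norm_pow, norm_mul, mul_pow]; simp
    rw [h2, norm_one] at this
    linarith
  have h2 : -Real.log ‖1 - ((R : ℂ) * w) ^ 2‖ / R ≤ 0 :=
    div_nonpos_of_nonpos_of_nonneg (by linarith) hR.le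
  have n1 := Complex.slitPlane_ne_zero (one_add_mul_mem_slitPlane R hw)
  have n2 := Complex.slitPlane_ne_zero (one_add_mul_mem_slitPlane R (w := -w) (by simpa using hw))
  have hsq : ‖1 + (R : ℂ) * w‖ ^ 2 - ‖1 + (R : ℂ) * (-w)‖ ^ 2 = 4 * R * w.re := by
    rw [Complex.sq_norm, Complex.sq_norm, Complex.normSq_apply, Complex.normSq_apply]
    simp; ring
  have h3 : w.re * (Real.log ‖1 + (R : ℂ) * (-w)‖ - Real.log ‖1 + (R : ℂ) * w‖) ≤ 0 := by
    rcases le_total 0 w.re with h | h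
    · refine mul_nonpos_of_nonneg_of_nonpos h (sub_nonpos.2 (Real.log_le_log (by positivity) ?_))
      refine le_of_sq_le_sq ?_ (norm_nonneg _)
      have : 0 ≤ 4 * R * w.re := by positivity
      linarith
    · refine mul_nonpos_of_nonpos_of_nonneg h (sub_nonneg.2 (Real.log_le_log (by positivity) ?_))
      refine le_of_sq_le_sq ?_ (norm_nonneg _)
      have : 4 * R * w.re ≤ 0 := mul_nonpos_of_nonneg_of_nonpos (by positivity) h
      linarith
  have h4 : -(w.im * (Complex.arg (1 + (R : ℂ) * (-w)) - Complex.arg (1 + (R : ℂ) * w))) ≤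
      2 * Real.pi * |w.im| := by
    refine (neg_le_abs _).trans ?_
    rw [abs_mul, mul_comm]
    gcongr
    refine (abs_sub _ _).trans ?_
    linarith [Complex.abs_arg_le_pi (1 + (R : ℂ) * (-w)), Complex.abs_arg_le_pi (1 + (R : ℂ) * w)]
  rw [Complex.mul_re, Complex.sub_re, Complex.sub_im, Complex.log_re, Complex.log_re,
    Complex.log_im, Complex.log_im]
  linarith

/-! ### Power integrals, and crude bounds with weight `t ^ (-p - 1)`. -/

lemma lintegral_rpow_Ioo {q R : ℝ} (hq : -1 < q) (hR : 0 ≤ R) :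
    ∫⁻ t in Ioo 0 R, ENNReal.ofReal (t ^ q) = ENNReal.ofReal (R ^ (q + 1) / (q + 1)) := by
  have hi : IntegrableOn (fun t : ℝ => t ^ q) (Ioo 0 R) :=
    (intervalIntegrable_iff_integrableOn_Ioo_of_le hR).1
      (intervalIntegral.intervalIntegrable_rpow' hq)
  rw [← ofReal_integral_eq_lintegral_ofReal hi]
  · rw [← integral_Ioc_eq_integral_Ioo, ← intervalIntegral.integral_of_le hR,
      integral_rpow (Or.inl hq), Real.zero_rpow (by linarith), sub_zero]
  · filter_upwards [ae_restrict_mem measurableSet_Ioo] with t ht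
    exact Real.rpow_nonneg ht.1.le _

lemma lintegral_rpow_Ioi {q c : ℝ} (hq : q < -1) (hc : 0 < c) :
    ∫⁻ t in Ioi c, ENNReal.ofReal (t ^ q) = ENNReal.ofReal (-c ^ (q + 1) / (q + 1)) := by
  rw [← ofReal_integral_eq_lintegral_ofReal (integrableOn_Ioi_rpow_of_lt hq hc)]
  · rw [integral_Ioi_rpow_of_lt hq hc]
  · filter_upwards [ae_restrict_mem measurableSet_Ioi] with t ht
    exact Real.rpow_nonneg (hc.le.trans (le_of_lt ht)) _

lemma pow_div_rpow {t : ℝ} (ht : 0 < t) (p : ℝ) (n : ℕ) : t ^ n / t ^ (p + 1) = t ^ (n - 1 - p) := by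
  rw [← Real.rpow_natCast, ← Real.rpow_sub ht]; ring_nf

lemma lintegral_min_le {p : ℝ} (hp1 : 1 < p) (hp2 : p < 2) {b : ℝ} (hb : 0 ≤ b) :
    ∫⁻ t in Ioi (0 : ℝ), ENNReal.ofReal (min ((t * b) ^ 2) (2 * (t * b)) / t ^ (p + 1)) ≤
      ENNReal.ofReal ((1 / (2 - p) + 2 / (p - 1)) * b ^ p) := by
  rcases hb.eq_or_lt with rfl | hb
  · simp
  have hc : 0 < b⁻¹ := by positivity
  have h2p : 0 < 2 - p := by linarith
  have hp1' : 0 < p - 1 := by linarith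
  rw [show Ioi (0 : ℝ) = Ioo 0 b⁻¹ ∪ Ici b⁻¹ from (Ioo_union_Ici_eq_Ioi hc).symm]
  refine (lintegral_union_le _ _ _).trans ?_
  rw [add_mul, ENNReal.ofReal_add (by positivity) (by positivity)]
  gcongr
  · calc _ ≤ ∫⁻ t in Ioo 0 b⁻¹, ENNReal.ofReal (b ^ 2) * ENNReal.ofReal (t ^ (1 - p)) := by
          refine setLIntegral_mono' measurableSet_Ioo fun t ht => ?_
          rw [← ENNReal.ofReal_mul (by positivity)]
          refine ENNReal.ofReal_le_ofReal ?_
          have e := pow_div_rpow ht.1 p 2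
          have e2 : ((2 : ℕ) : ℝ) - 1 - p = 1 - p := by norm_num
          rw [e2] at e
          rw [← e, ← mul_div_assoc]
          have := ht.1
          gcongr
          exact (min_le_left _ _).trans (by rw [mul_pow, mul_comm])
      _ = _ := by
          rw [lintegral_const_mul' _ _ ENNReal.ofReal_ne_top, lintegral_rpow_Ioo (by linarith) hc.le,
            ← ENNReal.ofReal_mul (by positivity)]
          congr 1
          rw [Real.inv_rpow hb.le, ← Real.rpow_neg hb.le, ← mul_div_assoc, ← Real.rpow_natCast,
            ← Real.rpow_add hb]
          push_cast
          rw [show (2 : ℝ) + -(1 - p + 1) = p by ring, show 1 - p + 1 = 2 - p by ring]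
          ring
  · calc _ ≤ ∫⁻ t in Ici b⁻¹, ENNReal.ofReal (2 * b) * ENNReal.ofReal (t ^ (-p)) := by
          refine setLIntegral_mono' measurableSet_Ici fun t ht => ?_
          have ht0 : 0 < t := hc.trans_le ht
          rw [← ENNReal.ofReal_mul (by positivity)]
          refine ENNReal.ofReal_le_ofReal ?_
          have e := pow_div_rpow ht0 p 1
          have e2 : ((1 : ℕ) : ℝ) - 1 - p = -p := by norm_num
          rw [e2, pow_one] at e
          rw [← e, ← mul_div_assoc]
          gcongr
          exact (min_le_right _ _).trans (by linarith)
      _ = _ := by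
          rw [lintegral_const_mul' _ _ ENNReal.ofReal_ne_top, setLIntegral_congr Ioi_ae_eq_Ici.symm,
            lintegral_rpow_Ioi (by linarith) hc, ← ENNReal.ofReal_mul (by positivity)]
          congr 1
          rw [Real.inv_rpow hb.le, ← Real.rpow_neg hb.le]
          have : b * b ^ (-(-p + 1)) = b ^ p := by
            nth_rw 1 [← Real.rpow_one b]
            rw [← Real.rpow_add hb]; ring_nf
          rw [← this, show -p + 1 = -(p - 1) by ring, neg_div_neg_eq]
          ring

/-- The positive part of the integral of `log |1 - (t w)²| / t ^ (p + 1)` over `(0, R)`. -/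
def posInt (p R : ℝ) (w : ℂ) : ℝ≥0∞ :=
  ∫⁻ t in Ioo 0 R, ENNReal.ofReal (Real.log ‖1 - ((t : ℂ) * w) ^ 2‖ / t ^ (p + 1))

/-- The negative part of the integral of `log |1 - (t w)²| / t ^ (p + 1)` over `(0, R)`. -/
def negInt (p R : ℝ) (w : ℂ) : ℝ≥0∞ :=
  ∫⁻ t in Ioo 0 R, ENNReal.ofReal (-Real.log ‖1 - ((t : ℂ) * w) ^ 2‖ / t ^ (p + 1))

lemma posInt_le {p : ℝ} (hp1 : 1 < p) (hp2 : p < 2) (R : ℝ) (w : ℂ) :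
    posInt p R w ≤ ENNReal.ofReal ((1 / (2 - p) + 2 / (p - 1)) * ‖w‖ ^ p) := by
  refine le_trans ?_ (lintegral_min_le hp1 hp2 (norm_nonneg w))
  refine le_trans ?_ (lintegral_mono_set fun t (ht : t ∈ Ioo 0 R) => ht.1)
  refine setLIntegral_mono' measurableSet_Ioo fun t ht => ENNReal.ofReal_le_ofReal ?_
  have := ht.1
  gcongr
  exact log_norm_one_sub_sq_le_min ht.1.le w

/-- This bound depends on `R` but is summable over the zeros; it serves only to make the positive
parts finite so that they can be cancelled. -/
lemma posInt_le_sq {p : ℝ} (hp2 : p < 2) {R : ℝ} (hR : 0 ≤ R) (w : ℂ) :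
    posInt p R w ≤ ENNReal.ofReal (‖w‖ ^ 2 * (R ^ (2 - p) / (2 - p))) := by
  have e : ((2 : ℕ) : ℝ) - 1 - p = 1 - p := by norm_num
  rw [ENNReal.ofReal_mul (by positivity), show 2 - p = 1 - p + 1 by ring,
    ← lintegral_rpow_Ioo (by linarith) hR, ← lintegral_const_mul' _ _ ENNReal.ofReal_ne_top]
  refine setLIntegral_mono' measurableSet_Ioo fun t ht => ?_
  have := ht.1
  rw [← ENNReal.ofReal_mul (by positivity), ← e, ← pow_div_rpow ht.1 p 2, ← mul_div_assoc]
  refine ENNReal.ofReal_le_ofReal ?_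
  gcongr
  exact ((log_norm_one_sub_sq_le_min ht.1.le w).trans (min_le_left _ _)).trans
    (by rw [mul_pow, mul_comm])

/-- For `t |w| ≤ √2` the quartic term is at most `2 t² |w|²`, which cancels the contribution of `Re
w` and leaves `log |1 - (t w)²| ≤ 2 t² (Im w)²`. -/
lemma posInt_le_of_small {p : ℝ} (hp2 : p < 2) {R : ℝ} (hR : 0 ≤ R) {w : ℂ}
    (h : R ^ 2 * ‖w‖ ^ 2 < 2) :
    posInt p R w ≤ ENNReal.ofReal (2 * w.im ^ 2 * (R ^ (2 - p) / (2 - p))) := by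
  have e : ((2 : ℕ) : ℝ) - 1 - p = 1 - p := by norm_num
  rw [ENNReal.ofReal_mul (by positivity), show 2 - p = 1 - p + 1 by ring,
    ← lintegral_rpow_Ioo (by linarith) hR, ← lintegral_const_mul' _ _ ENNReal.ofReal_ne_top]
  refine setLIntegral_mono' measurableSet_Ioo fun t ht => ?_
  have ht0 := ht.1
  rw [← ENNReal.ofReal_mul (by positivity), ← e, ← pow_div_rpow ht.1 p 2, ← mul_div_assoc]
  refine ENNReal.ofReal_le_ofReal ?_
  gcongr
  by_cases h0 : 1 - ((t : ℂ) * w) ^ 2 = 0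
  · rw [h0, norm_zero, Real.log_zero]; positivity
  refine (log_norm_one_sub_sq_le h0).trans ?_
  have h1 : t ^ 2 * ‖w‖ ^ 2 ≤ 2 := by
    have : t ^ 2 * ‖w‖ ^ 2 ≤ R ^ 2 * ‖w‖ ^ 2 := by
      have := ht.2.le
      gcongr
    linarith
  have h2 : ‖w‖ ^ 2 = w.re ^ 2 + w.im ^ 2 := by
    rw [Complex.sq_norm, Complex.normSq_apply]; ring
  have h3 : t ^ 2 * (‖w‖ ^ 2) ^ 2 ≤ 2 * ‖w‖ ^ 2 := by
    rw [pow_two (‖w‖ ^ 2), ← mul_assoc]; gcongr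
  have h4 : t ^ 2 * (t ^ 2 * (‖w‖ ^ 2) ^ 2 - 2 * (w.re ^ 2 - w.im ^ 2)) ≤
      t ^ 2 * (4 * w.im ^ 2) := by
    gcongr; linarith
  linarith

lemma integrableOn_log_div_rpow {p : ℝ} (hp2 : p < 2) {w : ℂ} (hw : w.im ≠ 0) {R : ℝ} (hR : 0 ≤ R) :
    IntegrableOn (fun t : ℝ => Real.log ‖1 - ((t : ℂ) * w) ^ 2‖ / t ^ (p + 1)) (Ioo 0 R) := by
  obtain ⟨M, hM, h⟩ := abs_log_norm_one_sub_sq_le hw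
  have hi : IntegrableOn (fun t : ℝ => t ^ (1 - p)) (Ioo 0 R) :=
    (intervalIntegrable_iff_integrableOn_Ioo_of_le hR).1
      (intervalIntegral.intervalIntegrable_rpow' (by linarith))
  refine (hi.const_mul M).mono'
    (((measurable_log_norm_one_sub_sq w).div (by fun_prop)).aestronglyMeasurable) ?_
  filter_upwards [ae_restrict_mem measurableSet_Ioo] with t ht
  have ht0 : 0 < t := ht.1
  have e : ((2 : ℕ) : ℝ) - 1 - p = 1 - p := by norm_num
  rw [Real.norm_eq_abs, abs_div, abs_of_pos (Real.rpow_pos_of_pos ht0 _), ← e,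
    ← pow_div_rpow ht0 p 2, ← mul_div_assoc]
  gcongr
  exact h t ht0.le

/-! ### Negativity of the kernel near the real axis. -/

/-- The constant `h₀` is the value of the decreasing function `t ^ (1 - p)` where the logarithm
changes sign, so replacing `t ^ (1 - p)` by `h₀` can only increase the product with it. The
indicator records a definite gain well inside the negative range. -/
lemma log_div_rpow_le {p : ℝ} (hp1 : 1 < p) {w : ℂ} (hw : w.im ≠ 0)
    (hsmall : 8 * w.im ^ 2 ≤ ‖w‖ ^ 2) :
    ∃ h₀ : ℝ, 0 ≤ h₀ ∧ h₀ ≤ ‖w‖ ^ (p - 1) ∧ ∀ t : ℝ, 0 < t →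
      Real.log ‖1 - ((t : ℂ) * w) ^ 2‖ / t ^ (p + 1) ≤
        h₀ * (Real.log ‖1 - ((t : ℂ) * w) ^ 2‖ / t ^ 2) -
          (Icc (1 / (4 * ‖w‖)) (1 / (2 * ‖w‖))).indicator
            (fun _ => (2 ^ (p - 1) - 1) / 2 * (‖w‖ ^ 2 * ‖w‖ ^ (p - 1))) t := by
  have hw0 : w ≠ 0 := by rintro rfl; simp at hw
  set b := ‖w‖ with hbdef
  have hb : 0 < b := by positivity
  have hb2 : b ^ 2 = w.re ^ 2 + w.im ^ 2 := by
    rw [hbdef, Complex.sq_norm, Complex.normSq_apply]; ring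
  set D := w.re ^ 2 - w.im ^ 2 with hD
  have hDb : 3 / 4 * b ^ 2 ≤ D := by rw [hD]; linarith
  have hDpos : 0 < D := by have : 0 < b ^ 2 := by positivity
                           linarith
  -- The positive solution of `|1 - (t w)²| = 1`.
  set t₀ := Real.sqrt (2 * D) / b ^ 2 with ht₀
  have ht₀pos : 0 < t₀ := by positivity
  have ht₀sq : t₀ ^ 2 * (b ^ 2) ^ 2 = 2 * D := by
    rw [ht₀, div_pow, Real.sq_sqrt (by positivity)]; field_simp
  have hbt : 1 ≤ t₀ * b := by
    have : (1 : ℝ) ^ 2 ≤ (t₀ * b) ^ 2 := by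
      have h1 : (t₀ * b) ^ 2 * b ^ 2 = 2 * D := by rw [← ht₀sq]; ring
      have h2 : 0 < b ^ 2 := by positivity
      nlinarith
    exact le_of_sq_le_sq this (by positivity)
  have hanti : ∀ {x y : ℝ}, 0 < x → x ≤ y → y ^ (1 - p) ≤ x ^ (1 - p) := fun hx hxy =>
    Real.rpow_le_rpow_of_nonpos hx hxy (by linarith)
  have hinv : ∀ {x : ℝ}, 0 < x → (1 / x) ^ (1 - p) = x ^ (p - 1) := fun {x} hx => by
    rw [one_div, Real.inv_rpow hx.le, ← Real.rpow_neg hx.le, neg_sub]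
  have hh₀ : t₀ ^ (1 - p) ≤ b ^ (p - 1) := by
    rw [← hinv hb]
    exact hanti (by positivity) (by rw [div_le_iff₀ hb]; exact hbt)
  have hκ : 1 ≤ (2 : ℝ) ^ (p - 1) := Real.one_le_rpow one_le_two (by linarith)
  refine ⟨t₀ ^ (1 - p), by positivity, hh₀, fun t ht => ?_⟩
  have ha0 := one_sub_sq_ne_zero t hw
  set a := Real.log ‖1 - ((t : ℂ) * w) ^ 2‖ with ha
  have e : ((2 : ℕ) : ℝ) - 1 - p = 1 - p := by norm_num
  have hsplit : a / t ^ (p + 1) = a / t ^ 2 * t ^ (1 - p) := by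
    rw [← e, ← pow_div_rpow ht p 2]; field_simp
  rw [hsplit]
  have hup : a / t ^ 2 ≤ (t ^ 2 * (b ^ 2) ^ 2 - 2 * D) / 2 := by
    rw [div_le_iff₀ (by positivity)]
    have := log_norm_one_sub_sq_le ha0
    linarith
  by_cases hmem : t ∈ Icc (1 / (4 * b)) (1 / (2 * b))
  · rw [indicator_of_mem hmem]
    have htb : t * b ≤ 1 / 2 := by
      have := hmem.2
      rw [le_div_iff₀ (by positivity)] at this
      linarith
    have h1 : t ^ 2 * (b ^ 2) ^ 2 ≤ 1 / 4 * b ^ 2 := by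
      have : t ^ 2 * (b ^ 2) ^ 2 = (t * b) ^ 2 * b ^ 2 := by ring
      rw [this]
      have : (t * b) ^ 2 ≤ (1 / 2) ^ 2 := by gcongr
      have : 0 ≤ b ^ 2 := by positivity
      nlinarith
    have h2 : a / t ^ 2 ≤ -(b ^ 2 / 2) := by linarith
    -- As `t ≤ 1 / (2 b)` while `t₀ ≥ 1 / b`, the two weights differ by at least `(2 ^ (p - 1) - 1)
    -- * b ^ (p - 1)`.
    have h3 : 2 ^ (p - 1) * b ^ (p - 1) ≤ t ^ (1 - p) := by
      rw [← Real.mul_rpow (by norm_num) hb.le, ← hinv (by positivity)]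
      exact hanti ht hmem.2
    have h4 : 0 ≤ b ^ (p - 1) := by positivity
    have h5 : (2 ^ (p - 1) - 1) * b ^ (p - 1) ≤ t ^ (1 - p) - t₀ ^ (1 - p) := by linarith
    have h6 : 0 ≤ (2 ^ (p - 1) - 1) * b ^ (p - 1) := mul_nonneg (by linarith) h4
    have h7 : 0 ≤ b ^ 2 / 2 := by positivity
    have h8 : b ^ 2 / 2 * ((2 ^ (p - 1) - 1) * b ^ (p - 1)) ≤
        (-(a / t ^ 2)) * (t ^ (1 - p) - t₀ ^ (1 - p)) :=
      mul_le_mul (by linarith) h5 h6 (by linarith)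
    linarith
  · rw [indicator_of_notMem hmem, sub_zero, mul_comm]
    rcases le_total t t₀ with h | h
    · refine mul_le_mul_of_nonpos_right (hanti ht h) (hup.trans ?_)
      have : t ^ 2 * (b ^ 2) ^ 2 ≤ t₀ ^ 2 * (b ^ 2) ^ 2 := by gcongr
      linarith
    · refine mul_le_mul_of_nonneg_right (hanti ht₀pos h) (div_nonneg ?_ (by positivity))
      apply Real.log_nonneg
      have h1 : t₀ ^ 2 * (b ^ 2) ^ 2 ≤ t ^ 2 * (b ^ 2) ^ 2 := by gcongr
      have h2 := norm_one_sub_sq_sq t w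
      have h3 : (1 : ℝ) ^ 2 ≤ ‖1 - ((t : ℂ) * w) ^ 2‖ ^ 2 := by
        rw [h2, ← hbdef, ← hD]
        have : 0 ≤ t ^ 2 * (t ^ 2 * (b ^ 2) ^ 2 - 2 * D) := mul_nonneg (by positivity) (by linarith)
        linarith
      exact le_of_sq_le_sq h3 (norm_nonneg _)

/-- The aperture of the angle around the real axis in which `log |1 - (t w)²|` has an integral
that is negative, of the order of `-|w| ^ p`. -/
def aperture (p : ℝ) : ℝ := (2 ^ (p - 1) - 1) / (32 * Real.pi)

lemma two_rpow_sub_one_pos {p : ℝ} (hp1 : 1 < p) : (0 : ℝ) < 2 ^ (p - 1) - 1 :=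
  sub_pos.2 (Real.one_lt_rpow one_lt_two (by linarith))

lemma aperture_pos {p : ℝ} (hp1 : 1 < p) : 0 < aperture p :=
  div_pos (two_rpow_sub_one_pos hp1) (by positivity)

lemma aperture_le {p : ℝ} (hp2 : p < 2) : aperture p ≤ 1 / 32 := by
  have h : (2 : ℝ) ^ (p - 1) ≤ 2 ^ (1 : ℝ) :=
    Real.rpow_le_rpow_of_exponent_le one_le_two (by linarith)
  rw [Real.rpow_one] at h
  have := Real.pi_gt_three
  unfold aperture
  rw [div_le_div_iff₀ (by positivity) (by norm_num)]
  linarith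

lemma integral_log_div_rpow_le {p : ℝ} (hp1 : 1 < p) (hp2 : p < 2) {w : ℂ} (hw : w.im ≠ 0)
    (hδ : |w.im| ≤ aperture p * ‖w‖) {R : ℝ} (hR : 0 < R) (hRw : 2 ≤ R ^ 2 * ‖w‖ ^ 2) :
    ∫ t in Ioo 0 R, Real.log ‖1 - ((t : ℂ) * w) ^ 2‖ / t ^ (p + 1) ≤
      -((2 ^ (p - 1) - 1) / 16 * ‖w‖ ^ p) := by
  have hw0 : w ≠ 0 := by rintro rfl; simp at hw
  have hb : 0 < ‖w‖ := by positivity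
  have hsmall : 8 * w.im ^ 2 ≤ ‖w‖ ^ 2 := by
    have h1 : |w.im| ≤ 1 / 32 * ‖w‖ := hδ.trans (by gcongr; exact aperture_le hp2)
    have h2 : |w.im| ^ 2 ≤ (1 / 32 * ‖w‖) ^ 2 := by gcongr
    rw [sq_abs] at h2
    nlinarith [sq_nonneg ‖w‖]
  obtain ⟨h₀, hh0, hh1, hle⟩ := log_div_rpow_le hp1 hw hsmall
  have hJ := integral_log_div_sq_le hw hR hRw
  have hJi := integrableOn_log_div_sq hw R
  have hκ := two_rpow_sub_one_pos hp1
  set lo := 1 / (4 * ‖w‖) with hlo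
  set hi := 1 / (2 * ‖w‖) with hhi
  have hhiR : hi < R := by
    rw [hhi, div_lt_iff₀ (by positivity)]
    by_contra hcon
    push Not at hcon
    have : R * ‖w‖ ≤ 1 / 2 := by linarith
    have : (R * ‖w‖) ^ 2 ≤ (1 / 2) ^ 2 := by gcongr
    rw [mul_pow] at this
    linarith
  have hsub : Icc lo hi ⊆ Ioo 0 R := fun t ht =>
    ⟨lt_of_lt_of_le (by positivity) ht.1, ht.2.trans_lt hhiR⟩
  set g := (2 ^ (p - 1) - 1) / 2 * (‖w‖ ^ 2 * ‖w‖ ^ (p - 1)) with hg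
  have hGi : IntegrableOn ((Icc lo hi).indicator fun _ => g) (Ioo 0 R) :=
    ((integrable_const g).indicator measurableSet_Icc)
  have hb3 : ‖w‖ * ‖w‖ ^ (p - 1) = ‖w‖ ^ p := by
    nth_rw 1 [← Real.rpow_one ‖w‖]
    rw [← Real.rpow_add hb]; ring_nf
  have hGint : ∫ t in Ioo 0 R, (Icc lo hi).indicator (fun _ => g) t =
      (2 ^ (p - 1) - 1) / 8 * ‖w‖ ^ p := by
    rw [setIntegral_indicator measurableSet_Icc, inter_eq_right.2 hsub, setIntegral_const,
      Real.volume_real_Icc_of_le (by rw [hlo, hhi]; gcongr; norm_num), smul_eq_mul, hg, ← hb3, hlo,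
      hhi]
    field_simp
    norm_num
  calc _ ≤ ∫ t in Ioo 0 R, (h₀ * (Real.log ‖1 - ((t : ℂ) * w) ^ 2‖ / t ^ 2) -
        (Icc lo hi).indicator (fun _ => g) t) :=
        setIntegral_mono_on (integrableOn_log_div_rpow hp2 hw hR.le)
          (Integrable.sub' (hJi.const_mul h₀) hGi) measurableSet_Ioo fun t ht => hle t ht.1
    _ = h₀ * (∫ t in Ioo 0 R, Real.log ‖1 - ((t : ℂ) * w) ^ 2‖ / t ^ 2) -
        (2 ^ (p - 1) - 1) / 8 * ‖w‖ ^ p := by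
        rw [integral_sub (hJi.const_mul h₀) hGi, integral_const_mul, hGint]
    -- `aperture p` is chosen so that this error is `(2 ^ (p - 1) - 1) / 16 * ‖w‖ ^ p`, half of the
    -- gain.
    _ ≤ ‖w‖ ^ (p - 1) * (2 * Real.pi * (aperture p * ‖w‖)) -
        (2 ^ (p - 1) - 1) / 8 * ‖w‖ ^ p := by
        refine sub_le_sub_right ?_ _
        calc _ ≤ h₀ * (2 * Real.pi * |w.im|) := mul_le_mul_of_nonneg_left hJ hh0
          _ ≤ _ := by gcongr
    _ = _ := by
        rw [← hb3, aperture]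
        field_simp
        ring

lemma ofReal_add_posInt_le_negInt_of_im_ne_zero {p : ℝ} (hp1 : 1 < p) (hp2 : p < 2) {w : ℂ}
    (hw : w.im ≠ 0) (hδ : |w.im| ≤ aperture p * ‖w‖) {R : ℝ} (hR : 0 < R)
    (hRw : 2 ≤ R ^ 2 * ‖w‖ ^ 2) :
    ENNReal.ofReal ((2 ^ (p - 1) - 1) / 16 * ‖w‖ ^ p) + posInt p R w ≤ negInt p R w := by
  have hκ := two_rpow_sub_one_pos hp1
  have hi := integrableOn_log_div_rpow hp2 hw hR.le
  have h1 := integral_log_div_rpow_le hp1 hp2 hw hδ hR hRw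
  rw [integral_eq_lintegral_pos_part_sub_lintegral_neg_part hi] at h1
  have hpos : posInt p R w ≠ ∞ := by
    exact ((posInt_le hp1 hp2 R w).trans_lt ENNReal.ofReal_lt_top).ne
  have hneg : negInt p R w ≠ ∞ := by
    have := hi.neg.lintegral_lt_top
    unfold negInt
    simp_rw [neg_div]
    exact this.ne
  have e : ∫⁻ t in Ioo 0 R, ENNReal.ofReal
      (-(Real.log ‖1 - ((t : ℂ) * w) ^ 2‖ / t ^ (p + 1))) = negInt p R w := by
    unfold negInt; simp_rw [neg_div]
  rw [e] at h1
  change (posInt p R w).toReal - _ ≤ _ at h1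
  rw [← ENNReal.ofReal_toReal hpos, ← ENNReal.ofReal_toReal hneg,
    ← ENNReal.ofReal_add (by positivity) ENNReal.toReal_nonneg]
  exact ENNReal.ofReal_le_ofReal (by linarith)

lemma norm_one_sub_sq_le_of_im_eq_zero {w : ℂ} (hw : w.im = 0) (t η : ℝ) :
    ‖1 - ((t : ℂ) * w) ^ 2‖ ≤ ‖1 - ((t : ℂ) * (w + η * Complex.I)) ^ 2‖ := by
  refine le_of_sq_le_sq ?_ (norm_nonneg _)
  rw [norm_one_sub_sq_sq, norm_one_sub_sq_sq, Complex.sq_norm, Complex.sq_norm,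
    Complex.normSq_apply, Complex.normSq_apply]
  simp [hw]
  nlinarith [sq_nonneg (t * η), sq_nonneg (t * w.re * (t * η)), sq_nonneg ((t * η) ^ 2)]

/-- For real `w` the logarithm is singular on the path. Moving `w` vertically to the edge of the
angle increases `|1 - (t w)²|`, so the positive part grows, the negative part shrinks, and the
nonreal case applies. -/
lemma ofReal_add_posInt_le_negInt {p : ℝ} (hp1 : 1 < p) (hp2 : p < 2) {w : ℂ}
    (hδ : |w.im| ≤ aperture p * ‖w‖) {R : ℝ} (hR : 0 < R) (hRw : 2 ≤ R ^ 2 * ‖w‖ ^ 2) :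
    ENNReal.ofReal ((2 ^ (p - 1) - 1) / 16 * ‖w‖ ^ p) + posInt p R w ≤ negInt p R w := by
  by_cases hw : w.im = 0
  swap
  · exact ofReal_add_posInt_le_negInt_of_im_ne_zero hp1 hp2 hw hδ hR hRw
  have hκ := two_rpow_sub_one_pos hp1
  have hb : 0 < ‖w‖ := by
    rcases (norm_nonneg w).eq_or_lt with h | h
    · rw [← h] at hRw; norm_num at hRw
    · exact h
  have hδ0 := aperture_pos hp1
  set η := aperture p * ‖w‖ with hη
  have hη0 : 0 < η := by positivity
  set v := w + η * Complex.I with hv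
  have hvim : v.im = η := by simp [hv, hw]
  have hwv : ‖w‖ ≤ ‖v‖ := by
    refine le_of_sq_le_sq ?_ (norm_nonneg _)
    rw [Complex.sq_norm, Complex.sq_norm, Complex.normSq_apply, Complex.normSq_apply]
    simp [hv, hw]
    nlinarith
  have hle := fun t : ℝ => norm_one_sub_sq_le_of_im_eq_zero hw t η
  have hvne : v.im ≠ 0 := by rw [hvim]; exact hη0.ne'
  have hae : ∀ᵐ t : ℝ ∂(volume.restrict (Ioo 0 R)), 0 < t ∧ ‖1 - ((t : ℂ) * w) ^ 2‖ ≠ 0 := by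
    have hne : ∀ᵐ t : ℝ ∂(volume.restrict (Ioo 0 R)), t ≠ 1 / |w.re| :=
      ae_restrict_of_ae (by simp [ae_iff])
    filter_upwards [ae_restrict_mem measurableSet_Ioo, hne] with t ht ht2
    refine ⟨ht.1, fun h0 => ht2 ?_⟩
    have h1 : ‖1 - ((t : ℂ) * w) ^ 2‖ ^ 2 = (1 - t ^ 2 * w.re ^ 2) ^ 2 := by
      rw [norm_one_sub_sq_sq, Complex.sq_norm, Complex.normSq_apply, hw]; ring
    rw [h0, zero_pow two_ne_zero, eq_comm, sq_eq_zero_iff] at h1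
    have h2 : (t * |w.re|) ^ 2 = 1 := by rw [mul_pow, sq_abs]; linarith
    have h3 : t * |w.re| = 1 :=
      (pow_eq_one_iff_of_nonneg (mul_nonneg ht.1.le (abs_nonneg _)) two_ne_zero).1 h2
    exact eq_one_div_of_mul_eq_one_left h3
  have hp : posInt p R w ≤ posInt p R v := by
    refine lintegral_mono_ae ?_
    filter_upwards [hae] with t ht
    refine ENNReal.ofReal_le_ofReal ?_
    have := ht.1
    gcongr
    · exact lt_of_le_of_ne (norm_nonneg _) ht.2.symm
    · exact hle t
  have hn : negInt p R v ≤ negInt p R w := by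
    refine lintegral_mono_ae ?_
    filter_upwards [hae] with t ht
    refine ENNReal.ofReal_le_ofReal ?_
    have := ht.1
    gcongr
    · exact lt_of_le_of_ne (norm_nonneg _) ht.2.symm
    · exact hle t
  calc _ ≤ ENNReal.ofReal ((2 ^ (p - 1) - 1) / 16 * ‖v‖ ^ p) + posInt p R v := by gcongr
    _ ≤ negInt p R v := by
        refine ofReal_add_posInt_le_negInt_of_im_ne_zero hp1 hp2 hvne ?_ hR (hRw.trans (by gcongr))
        rw [hvim, abs_of_pos hη0, hη]
        gcongr
    _ ≤ _ := hn

/-- Three cases: inside the angle with `R |w| ≥ √2` the negative part wins; outside it `|w| ^ p` is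
at most a multiple of `|Im w| ^ p`; for `R |w| < √2` the small-`t` bound suffices. The additive form
avoids subtraction in `ℝ≥0∞`. -/
lemma exists_ofReal_add_posInt_le {p : ℝ} (hp1 : 1 < p) (hp2 : p < 2) :
    ∃ c C : ℝ, 0 < c ∧ 0 < C ∧ ∀ (w : ℂ) (R : ℝ), 0 < R →
      ENNReal.ofReal (if 2 ≤ R ^ 2 * ‖w‖ ^ 2 then c * ‖w‖ ^ p else 0) + posInt p R w ≤
        negInt p R w + ENNReal.ofReal (C * |w.im| ^ p) := by
  have hκ := two_rpow_sub_one_pos hp1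
  have hδ0 := aperture_pos hp1
  have h2p : 0 < 2 - p := by linarith
  have hp1' : 0 < p - 1 := by linarith
  set c := ((2 : ℝ) ^ (p - 1) - 1) / 16 with hc
  have hcpos : 0 < c := by positivity
  set C₁ := 1 / (2 - p) + 2 / (p - 1) with hC₁
  have hC₁pos : 0 < C₁ := by positivity
  set C₂ := (c + C₁) * (1 / aperture p) ^ p with hC₂
  have hC₂pos : 0 < C₂ := by positivity
  refine ⟨c, C₂ + 4 / (2 - p), hcpos, by positivity, fun w R hR => ?_⟩
  have hy : |w.im| ≤ ‖w‖ := Complex.abs_im_le_norm w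
  by_cases hbig : 2 ≤ R ^ 2 * ‖w‖ ^ 2
  · rw [if_pos hbig]
    rcases le_or_gt |w.im| (aperture p * ‖w‖) with h | h
    · exact (ofReal_add_posInt_le_negInt hp1 hp2 h hR hbig).trans le_self_add
    · refine le_add_left ?_
      calc _ ≤ ENNReal.ofReal (c * ‖w‖ ^ p) + ENNReal.ofReal (C₁ * ‖w‖ ^ p) := by
            gcongr; exact posInt_le hp1 hp2 R w
        _ = ENNReal.ofReal ((c + C₁) * ‖w‖ ^ p) := by
            rw [← ENNReal.ofReal_add (by positivity) (by positivity), ← add_mul]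
        _ ≤ _ := by
            refine ENNReal.ofReal_le_ofReal ?_
            have h1 : ‖w‖ ≤ 1 / aperture p * |w.im| := by
              rw [one_div, inv_mul_eq_div, le_div_iff₀ hδ0]; linarith
            calc _ ≤ (c + C₁) * (1 / aperture p * |w.im|) ^ p := by gcongr
              _ = C₂ * |w.im| ^ p := by
                  rw [Real.mul_rpow (by positivity) (abs_nonneg _), hC₂]; ring
              _ ≤ _ := by gcongr; linarith [show 0 < 4 / (2 - p) by positivity]
  · rw [if_neg hbig, ENNReal.ofReal_zero, zero_add]
    push Not at hbig
    refine le_add_left ((posInt_le_of_small hp2 hR.le hbig).trans (ENNReal.ofReal_le_ofReal ?_))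
    -- The surplus power `|Im w| ^ (2 - p)` is absorbed by `R ^ (2 - p)`, since `R |Im w| ≤ R |w| <
    -- √2`; this keeps the constant independent of `R`.
    have h1 : w.im ^ 2 = |w.im| ^ p * |w.im| ^ (2 - p) := by
      rw [← Real.rpow_add' (abs_nonneg _) (by norm_num)]
      simp
    have h2 : |w.im| ^ (2 - p) * R ^ (2 - p) ≤ 2 := by
      rw [← Real.mul_rpow (abs_nonneg _) hR.le]
      have h3 : |w.im| * R ≤ 2 := by
        have : (|w.im| * R) ^ 2 ≤ 2 ^ 2 := by
          calc (|w.im| * R) ^ 2 ≤ (‖w‖ * R) ^ 2 := by gcongr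
            _ = R ^ 2 * ‖w‖ ^ 2 := by ring
            _ ≤ _ := by linarith
        exact le_of_sq_le_sq this (by norm_num)
      calc _ ≤ (2 : ℝ) ^ (2 - p) := by gcongr
        _ ≤ 2 ^ (1 : ℝ) := Real.rpow_le_rpow_of_exponent_le one_le_two (by linarith)
        _ = 2 := Real.rpow_one 2
    calc 2 * w.im ^ 2 * (R ^ (2 - p) / (2 - p))
        = 2 / (2 - p) * |w.im| ^ p * (|w.im| ^ (2 - p) * R ^ (2 - p)) := by rw [h1]; ring
      _ ≤ 2 / (2 - p) * |w.im| ^ p * 2 := by gcongr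
      _ = 4 / (2 - p) * |w.im| ^ p := by ring
      _ ≤ _ := by gcongr; linarith

/-! ### From products to sums of logarithms. -/

lemma tsum_ofReal_neg_le {b : ℕ → ℝ} {s : ℝ} (h : HasSum b s) :
    ∑' k, ENNReal.ofReal (-b k) ≤ ENNReal.ofReal (-s) + ∑' k, ENNReal.ofReal (b k) := by
  have hp : Summable fun k => max (b k) 0 :=
    h.summable.abs.of_nonneg_of_le (fun k => le_max_right _ _)
      fun k => max_le (le_abs_self _) (abs_nonneg _)
  have hn : HasSum (fun k => max (-b k) 0) (-s + ∑' k, max (b k) 0) := by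
    refine (h.neg.add hp.hasSum).congr_fun fun k => ?_
    rcases le_total (b k) 0 with hk | hk
    · rw [max_eq_left (by linarith), max_eq_right hk]; ring
    · rw [max_eq_right (by linarith), max_eq_left hk]; ring
  have e1 : ∑' k, ENNReal.ofReal (-b k) = ENNReal.ofReal (∑' k, max (-b k) 0) := by
    rw [ENNReal.ofReal_tsum_of_nonneg (fun k => le_max_right _ _) hn.summable]
    simp [ENNReal.ofReal_max]
  have e2 : ∑' k, ENNReal.ofReal (b k) = ENNReal.ofReal (∑' k, max (b k) 0) := by
    rw [ENNReal.ofReal_tsum_of_nonneg (fun k => le_max_right _ _) hp]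
    simp [ENNReal.ofReal_max]
  rw [e1, e2, hn.tsum_eq]
  exact ENNReal.ofReal_add_le

lemma hasSum_log_of_hasProd {g : ℕ → ℝ} {P : ℝ} (h : HasProd g P) (hP : P ≠ 0) :
    HasSum (fun k => Real.log (g k)) (Real.log P) := by
  have hne : ∀ k, g k ≠ 0 := fun k hk => hP <| by
    rw [← h.tprod_eq]; exact tprod_of_exists_eq_zero ⟨k, hk⟩
  have := (Real.continuousAt_log hP).tendsto.comp h
  refine this.congr fun s => ?_
  exact Real.log_prod fun k _ => hne k

lemma norm_primaryFactor_mul_neg (u : ℂ) :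
    ‖primaryFactor u‖ * ‖primaryFactor (-u)‖ = ‖1 - u ^ 2‖ := by
  rw [← norm_mul]
  congr 1
  unfold primaryFactor
  have : Complex.exp u * Complex.exp (-u) = 1 := by rw [← Complex.exp_add]; simp
  linear_combination (1 - u ^ 2) * this

/-! ### Growth of the maximum modulus. -/

lemma norm_primaryFactor_le (u : ℂ) :
    ‖primaryFactor u‖ ≤ Real.exp (min (‖u‖ ^ 2) (2 * ‖u‖)) := by
  have h1 : ‖primaryFactor u‖ ^ 2 ≤ Real.exp (‖u‖ ^ 2) ^ 2 := by
    have e : ‖1 - u‖ ^ 2 = ‖u‖ ^ 2 - 2 * u.re + 1 := by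
      rw [Complex.sq_norm, Complex.sq_norm, Complex.normSq_apply, Complex.normSq_apply]
      simp; ring
    rw [primaryFactor, norm_mul, mul_pow, Complex.norm_exp, e]
    calc _ ≤ Real.exp (‖u‖ ^ 2 - 2 * u.re) * Real.exp u.re ^ 2 := by
          gcongr; exact Real.add_one_le_exp _
      _ = Real.exp (‖u‖ ^ 2) := by
          rw [← Real.exp_nat_mul, ← Real.exp_add]; congr 1; push_cast; ring
      _ ≤ _ := by
          rw [← Real.exp_nat_mul]
          apply Real.exp_le_exp.2
          push_cast
          nlinarith [sq_nonneg ‖u‖]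
  have h2 : ‖primaryFactor u‖ ≤ Real.exp (2 * ‖u‖) := by
    rw [primaryFactor, norm_mul, Complex.norm_exp, two_mul, Real.exp_add]
    gcongr
    · calc ‖1 - u‖ ≤ ‖(1 : ℂ)‖ + ‖u‖ := norm_sub_le _ _
        _ ≤ _ := by rw [norm_one, add_comm]; exact Real.add_one_le_exp _
    · exact Complex.re_le_norm u
  rcases min_choice (‖u‖ ^ 2) (2 * ‖u‖) with h | h <;> rw [h]
  · exact le_of_sq_le_sq h1 (Real.exp_pos _).le
  · exact h2

lemma log_maxModulus_le {w : ℕ → ℂ} (hw : Summable fun k => ‖w k‖ ^ 2) {f : ℂ → ℂ}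
    (hf : ∀ z, HasProd (fun k => primaryFactor (z * w k)) (f z)) {r : ℝ} (hr : 0 ≤ r) :
    Summable (fun k => min ((r * ‖w k‖) ^ 2) (2 * (r * ‖w k‖))) ∧
    Real.log (maxModulus f r) ≤ ∑' k, min ((r * ‖w k‖) ^ 2) (2 * (r * ‖w k‖)) := by
  have h0 : ∀ k, 0 ≤ min ((r * ‖w k‖) ^ 2) (2 * (r * ‖w k‖)) := fun k => by positivity
  have hs : Summable (fun k => min ((r * ‖w k‖) ^ 2) (2 * (r * ‖w k‖))) :=
    (hw.mul_left (r ^ 2)).of_nonneg_of_le h0 fun k => (min_le_left _ _).trans (mul_pow _ _ _).le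
  refine ⟨hs, ?_⟩
  have hle : maxModulus f r ≤ Real.exp (∑' k, min ((r * ‖w k‖) ^ 2) (2 * (r * ‖w k‖))) := by
    refine csSup_le ((NormedSpace.sphere_nonempty.2 hr).image _) ?_
    rintro _ ⟨z, hz, rfl⟩
    have hz : ‖z‖ = r := by simpa using hz
    refine le_of_tendsto (hf z).norm (.of_forall fun s => ?_)
    calc ∏ k ∈ s, ‖primaryFactor (z * w k)‖
        ≤ ∏ k ∈ s, Real.exp (min ((r * ‖w k‖) ^ 2) (2 * (r * ‖w k‖))) := by
          refine Finset.prod_le_prod (fun k _ => norm_nonneg _) fun k _ => ?_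
          have := norm_primaryFactor_le (z * w k)
          rwa [norm_mul, hz] at this
      _ = Real.exp (∑ k ∈ s, min ((r * ‖w k‖) ^ 2) (2 * (r * ‖w k‖))) := (Real.exp_sum _ _).symm
      _ ≤ _ := Real.exp_le_exp.2 (hs.sum_le_tsum s fun k _ => h0 k)
  have hM : 0 ≤ maxModulus f r := Real.sSup_nonneg (by rintro _ ⟨z, -, rfl⟩; exact norm_nonneg _)
  rcases hM.eq_or_lt with h | h
  · rw [← h, Real.log_zero]; exact tsum_nonneg h0
  · exact (Real.log_le_iff_le_exp h).2 hle

lemma lintegral_log_maxModulus_le {p : ℝ} (hp1 : 1 < p) (hp2 : p < 2) {w : ℕ → ℂ}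
    (hw : Summable fun k => ‖w k‖ ^ 2) {f : ℂ → ℂ}
    (hf : ∀ z, HasProd (fun k => primaryFactor (z * w k)) (f z)) :
    ∫⁻ r in Ioi (0 : ℝ), ENNReal.ofReal (Real.log (maxModulus f r) / r ^ (p + 1)) ≤
      ENNReal.ofReal (1 / (2 - p) + 2 / (p - 1)) * ∑' k, ENNReal.ofReal (‖w k‖ ^ p) := by
  have h2p : 0 < 2 - p := by linarith
  have hp1' : 0 < p - 1 := by linarith
  calc _ ≤ ∫⁻ r in Ioi (0 : ℝ), ∑' k,
        ENNReal.ofReal (min ((r * ‖w k‖) ^ 2) (2 * (r * ‖w k‖)) / r ^ (p + 1)) := by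
        refine setLIntegral_mono' measurableSet_Ioi fun r hr => ?_
        have hr : 0 < r := hr
        obtain ⟨hs, hle⟩ := log_maxModulus_le hw hf hr.le
        rw [← ENNReal.ofReal_tsum_of_nonneg (fun k => by positivity) (hs.div_const _),
          tsum_div_const]
        gcongr
    _ = ∑' k, ∫⁻ r in Ioi (0 : ℝ),
        ENNReal.ofReal (min ((r * ‖w k‖) ^ 2) (2 * (r * ‖w k‖)) / r ^ (p + 1)) :=
        lintegral_tsum fun k => by fun_prop
    _ ≤ ∑' k, ENNReal.ofReal ((1 / (2 - p) + 2 / (p - 1)) * ‖w k‖ ^ p) :=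
        ENNReal.tsum_le_tsum fun k => lintegral_min_le hp1 hp2 (norm_nonneg _)
    _ = _ := by
        rw [← ENNReal.tsum_mul_left]
        congr 1 with k
        rw [ENNReal.ofReal_mul (by positivity)]

/-! ### Summation over the zeros. -/

lemma lintegral_Ioi_comp_neg (q : ℝ → ℝ≥0∞) :
    ∫⁻ t in Ioi (0 : ℝ), q (-t) = ∫⁻ t in Iio (0 : ℝ), q t := by
  have := (Measure.measurePreserving_neg (volume : Measure ℝ)).setLIntegral_comp_preimage_emb
    (MeasurableEquiv.neg ℝ).measurableEmbedding q (Iio 0)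
  simpa using this

lemma ae_product_ne_zero {w : ℕ → ℂ} (hw : Summable fun k => ‖w k‖ ^ 2) {f : ℂ → ℂ}
    (hf : ∀ z, HasProd (fun k => primaryFactor (z * w k)) (f z)) :
    ∀ᵐ t : ℝ, f t ≠ 0 ∧ f (-t) ≠ 0 := by
  have h1 := (countable_range fun k => ((w k)⁻¹).re).ae_notMem volume
  have h2 := (countable_range fun k => -((w k)⁻¹).re).ae_notMem volume
  filter_upwards [h1, h2] with t h1 h2
  constructor
  · refine product_ne_zero hw hf fun k hk => h1 ⟨k, ?_⟩
    simp only
    rw [← eq_inv_of_mul_eq_one_left hk, Complex.ofReal_re]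
  · refine product_ne_zero hw hf fun k hk => h2 ⟨k, ?_⟩
    simp only
    rw [← eq_inv_of_mul_eq_one_left hk, Complex.neg_re, Complex.ofReal_re, neg_neg]

/-- For almost every `t`, `∑ log |1 - (t wₖ)²| = log |f(t)| + log |f(-t)|`, so the negative parts
exceed the positive ones by at most `log⁻ |f(t)| + log⁻ |f(-t)|`; integrating over `t > 0` covers
both half-lines. -/
lemma tsum_negInt_le {w : ℕ → ℂ} (hw : Summable fun k => ‖w k‖ ^ 2) {f : ℂ → ℂ}
    (hf : ∀ z, HasProd (fun k => primaryFactor (z * w k)) (f z)) (p R : ℝ) :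
    ∑' k, negInt p R (w k) ≤
      (∫⁻ t : ℝ, ENNReal.ofReal (Real.posLog ‖f⁻¹ (t : ℂ)‖ / |t| ^ (p + 1))) +
        ∑' k, posInt p R (w k) := by
  set q : ℝ → ℝ≥0∞ := fun t => ENNReal.ofReal (Real.posLog ‖f⁻¹ (t : ℂ)‖ / |t| ^ (p + 1)) with hq
  have hfm : Measurable f := (differentiable_product hw hf).continuous.measurable
  have hqm : Measurable q := by
    have h1 : Measurable fun t : ℝ => ‖f⁻¹ (t : ℂ)‖ := by
      simp only [Pi.inv_apply]
      fun_prop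
    have h2 : Measurable fun t : ℝ => Real.posLog ‖f⁻¹ (t : ℂ)‖ := by
      unfold Real.posLog
      exact measurable_const.max h1.log
    fun_prop
  have hmeas : ∀ k, Measurable fun t : ℝ =>
      Real.log ‖1 - ((t : ℂ) * w k) ^ 2‖ := fun k => measurable_log_norm_one_sub_sq _
  calc ∑' k, negInt p R (w k) = ∫⁻ t in Ioo 0 R, ∑' k,
        ENNReal.ofReal (-Real.log ‖1 - ((t : ℂ) * w k) ^ 2‖ / t ^ (p + 1)) :=
        (lintegral_tsum fun k => by fun_prop).symm
    _ ≤ ∫⁻ t in Ioo 0 R, ((q t + q (-t)) + ∑' k,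
        ENNReal.ofReal (Real.log ‖1 - ((t : ℂ) * w k) ^ 2‖ / t ^ (p + 1))) := by
        refine lintegral_mono_ae ?_
        filter_upwards [ae_restrict_mem measurableSet_Ioo,
          ae_restrict_of_ae (ae_product_ne_zero hw hf)] with t ht hft
        have ht0 : 0 < t := ht.1
        have hT : 0 < t ^ (p + 1) := Real.rpow_pos_of_pos ht0 _
        have hprod : HasProd (fun k => ‖1 - ((t : ℂ) * w k) ^ 2‖) (‖f t‖ * ‖f (-t)‖) := by
          refine ((hf t).norm.mul (hf (-t)).norm).congr_fun fun k => ?_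
          rw [neg_mul, norm_primaryFactor_mul_neg]
        have hsum := (hasSum_log_of_hasProd hprod
          (mul_ne_zero (norm_ne_zero_iff.2 hft.1) (norm_ne_zero_iff.2 hft.2))).div_const
          (t ^ (p + 1))
        have h1 := tsum_ofReal_neg_le hsum
        simp only [neg_div] at h1 ⊢
        refine h1.trans (add_le_add_left ?_ _)
        simp only [hq]
        rw [← ENNReal.ofReal_add (div_nonneg Real.posLog_nonneg (by positivity))
          (div_nonneg Real.posLog_nonneg (by positivity)), abs_neg, abs_of_pos ht0, ← add_div,
          ← neg_div]
        refine ENNReal.ofReal_le_ofReal ?_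
        gcongr
        rw [Real.log_mul (norm_ne_zero_iff.2 hft.1) (norm_ne_zero_iff.2 hft.2), neg_add,
          ← Real.log_inv, ← Real.log_inv]
        simp only [Pi.inv_apply, norm_inv, Complex.ofReal_neg]
        exact add_le_add (le_max_right _ _) (le_max_right _ _)
    _ = (∫⁻ t in Ioo 0 R, (q t + q (-t))) + ∑' k, posInt p R (w k) := by
        rw [lintegral_add_left (by fun_prop), lintegral_tsum fun k => by fun_prop]
        rfl
    _ ≤ _ := by
        refine add_le_add_left ?_ _
        calc _ ≤ ∫⁻ t in Ioi 0, (q t + q (-t)) :=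
              lintegral_mono_set fun t (ht : t ∈ Ioo 0 R) => ht.1
          _ = (∫⁻ t in Ioi 0, q t) + ∫⁻ t in Iio 0, q t := by
              rw [lintegral_add_left hqm, lintegral_Ioi_comp_neg]
          _ = ∫⁻ t in Ioi 0 ∪ Iio 0, q t := by
              rw [lintegral_union measurableSet_Iio]
              exact disjoint_left.2 fun t h1 h2 => lt_asymm (mem_Ioi.1 h1) (mem_Iio.1 h2)
          _ ≤ ∫⁻ t, q t := setLIntegral_le_lintegral _ _

lemma exists_tsum_norm_rpow_le {p : ℝ} (hp1 : 1 < p) (hp2 : p < 2) :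
    ∃ K : ℝ≥0, ∀ (w : ℕ → ℂ) (f : ℂ → ℂ), (Summable fun k => ‖w k‖ ^ 2) →
      (∀ z, HasProd (fun k => primaryFactor (z * w k)) (f z)) →
      ∑' k, ENNReal.ofReal (‖w k‖ ^ p) ≤
        K * (∑' k, ENNReal.ofReal (|(w k).im| ^ p) + alphaP p f⁻¹) := by
  obtain ⟨c, C, hc, hC, hker⟩ := exists_ofReal_add_posInt_le hp1 hp2
  refine ⟨((Real.pi + C) / c).toNNReal, fun w f hw hf => ?_⟩
  set I := ∫⁻ t : ℝ, ENNReal.ofReal (Real.posLog ‖f⁻¹ (t : ℂ)‖ / |t| ^ (p + 1)) with hI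
  set G := ∑' k, ENNReal.ofReal (|(w k).im| ^ p) with hG
  have hIα : I = ENNReal.ofReal Real.pi * alphaP p f⁻¹ := by
    unfold alphaP
    rw [← mul_assoc, ← ENNReal.ofReal_mul Real.pi_pos.le, mul_one_div_cancel Real.pi_ne_zero,
      ENNReal.ofReal_one, one_mul]
  have h2p : 0 < 2 - p := by linarith
  have hR : ∀ R : ℝ, 0 < R →
      ∑' k, ENNReal.ofReal (if 2 ≤ R ^ 2 * ‖w k‖ ^ 2 then c * ‖w k‖ ^ p else 0) ≤
        I + ENNReal.ofReal C * G := by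
    intro R hR
    have hfin : ∑' k, posInt p R (w k) ≠ ∞ := by
      refine ((ENNReal.tsum_le_tsum fun k => posInt_le_sq hp2 hR.le (w k)).trans_lt ?_).ne
      rw [← ENNReal.ofReal_tsum_of_nonneg (fun k => by positivity) (hw.mul_right _)]
      exact ENNReal.ofReal_lt_top
    have h1 := ENNReal.tsum_le_tsum fun k => hker (w k) R hR
    rw [ENNReal.tsum_add, ENNReal.tsum_add] at h1
    have h2 : ∑' k, ENNReal.ofReal (C * |(w k).im| ^ p) = ENNReal.ofReal C * G := by
      rw [hG, ← ENNReal.tsum_mul_left]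
      congr 1 with k
      rw [ENNReal.ofReal_mul hC.le]
    rw [h2] at h1
    -- The same sum of positive parts stands on both sides and is finite for this `R`; the bound
    -- that survives no longer depends on `R`.
    refine (ENNReal.add_le_add_iff_right hfin).1 (h1.trans ?_)
    calc _ ≤ I + ∑' k, posInt p R (w k) + ENNReal.ofReal C * G := by
          gcongr; exact tsum_negInt_le hw hf p R
      _ = _ := add_right_comm _ _ _
  have hsum : ∑' k, ENNReal.ofReal (c * ‖w k‖ ^ p) ≤ I + ENNReal.ofReal C * G := by
    refine ENNReal.tsum_le_of_sum_range_le fun n => ?_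
    -- For a finite partial sum, one large `R` satisfies the threshold for all its nonzero `w k` at
    -- once.
    have hev : ∀ᶠ R : ℝ in atTop, ∀ k ∈ Finset.range n, w k ≠ 0 → 2 ≤ R ^ 2 * ‖w k‖ ^ 2 := by
      rw [Filter.eventually_all_finset]
      intro k _
      by_cases hk : w k = 0
      · simp [hk]
      · have : Tendsto (fun R : ℝ => R ^ 2 * ‖w k‖ ^ 2) atTop atTop :=
          (tendsto_pow_atTop two_ne_zero).atTop_mul_const (by positivity)
        filter_upwards [this.eventually_ge_atTop 2] with R hR _ using hR
    obtain ⟨R, hR1, hR2⟩ := (hev.and (eventually_gt_atTop 0)).exists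
    refine le_trans ?_ ((ENNReal.sum_le_tsum (Finset.range n)).trans (hR R hR2))
    refine Finset.sum_le_sum fun k hk => ENNReal.ofReal_le_ofReal ?_
    split_ifs with h
    · exact le_rfl
    · have : w k = 0 := by
        by_contra h0
        exact h (hR1 k hk h0)
      rw [this, norm_zero, Real.zero_rpow (by linarith), mul_zero]
  have hc' : ENNReal.ofReal c ≠ 0 := by simpa using hc
  have hsum' : ENNReal.ofReal c * ∑' k, ENNReal.ofReal (‖w k‖ ^ p) ≤
      ENNReal.ofReal (Real.pi + C) * (G + alphaP p f⁻¹) := by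
    rw [← ENNReal.tsum_mul_left]
    simp_rw [← ENNReal.ofReal_mul hc.le]
    refine hsum.trans ?_
    rw [hIα, mul_add, add_comm]
    gcongr
    · linarith [Real.pi_pos]
    · linarith
  change _ ≤ ENNReal.ofReal ((Real.pi + C) / c) * _
  rw [ENNReal.ofReal_div_of_pos hc, ENNReal.div_eq_inv_mul, mul_assoc]
  rwa [← ENNReal.mul_le_iff_le_inv hc' ENNReal.ofReal_ne_top]

end EntireFn

end

theorem theorem5 (p : ℝ) (hp1 : 1 < p) (hp2 : p < 2) :
    ∃ K : ℝ≥0, 0 < K ∧ ∀ f : ℂ → ℂ, EntireFn.IsCanonicalProductGenusOne f →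
      (∫⁻ r in Set.Ioi (0 : ℝ),
          ENNReal.ofReal (Real.log (EntireFn.maxModulus f r) / r ^ (p + 1))
        ≤ (K : ℝ≥0∞) * (EntireFn.gammaP p f + EntireFn.alphaP p f⁻¹)) ∧
      (EntireFn.zeroSum f (fun z => ENNReal.ofReal (‖z‖⁻¹ ^ p))
        ≤ (K : ℝ≥0∞) * (EntireFn.gammaP p f + EntireFn.alphaP p f⁻¹)) := by
  obtain ⟨K, hK⟩ := EntireFn.exists_tsum_norm_rpow_le hp1 hp2
  set C : ℝ≥0 := (1 / (2 - p) + 2 / (p - 1)).toNNReal with hC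
  have hp0 : p ≠ 0 := by linarith
  -- `C * K` serves the growth integral, `K` the sum over zeros, and `1` makes the constant
  -- positive.
  refine ⟨C * K + K + 1, by positivity, fun f ⟨w, hw, hf⟩ => ?_⟩
  have hγ : EntireFn.gammaP p f = ∑' k, ENNReal.ofReal (|(w k).im| ^ p) := by
    unfold EntireFn.gammaP
    rw [EntireFn.zeroSum_product hw hf]
    congr 1 with k
    split_ifs with h
    · simp [h, Real.zero_rpow hp0]
    · rw [inv_inv]
  have hz : EntireFn.zeroSum f (fun z => ENNReal.ofReal (‖z‖⁻¹ ^ p)) =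
      ∑' k, ENNReal.ofReal (‖w k‖ ^ p) := by
    rw [EntireFn.zeroSum_product hw hf]
    congr 1 with k
    split_ifs with h
    · simp [h, Real.zero_rpow hp0]
    · rw [norm_inv, inv_inv]
  have hmain := hK w f hw hf
  rw [hz, hγ]
  constructor
  · refine (EntireFn.lintegral_log_maxModulus_le hp1 hp2 hw hf).trans ?_
    calc _ ≤ (C : ℝ≥0∞) * (K * (∑' k, ENNReal.ofReal (|(w k).im| ^ p) +
          EntireFn.alphaP p f⁻¹)) := by gcongr; exact le_rfl
      _ = ((C * K : ℝ≥0) : ℝ≥0∞) * _ := by rw [ENNReal.coe_mul, mul_assoc]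
      _ ≤ _ := by gcongr; rw [add_assoc]; exact le_self_add
  · refine hmain.trans ?_
    gcongr
    exact le_add_self.trans le_self_add
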